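/- Let $d \ge 2$ and let $\mathcal{H}^2$ be the Hilbert space of functions on the open unit ball $B_d \subset \mathbb{C}^d$ with reproducing kernel $$K(z,w)=\frac{1}{1-z_1\overline{w_1}-\cdots-z_d\overline{w_d}}.$$ For $1\le j\le d$ let $M_{z_j}$ be the (bounded) operator of multiplication by the coordinate function $z_j$ on $\mathcal{H}^2$. A submodule of $\mathcal{H}^2$ is a closed linear subspace $\mathcal{M}\subset\mathcal{H}^2$ with $M_{z_j}\mathcal{M}\subset\mathcal{M}$ for every $j$. With respect to $\mathcal{H}^2=\mathcal{M}\oplus\mathcal{M}^\perp$ write $$M_{z_j}=\begin{pmatrix} R_{z_j} & J_{z_j}\\ 0 & S_{z_j}\end{pmatrix},\qquad 1\le j\le d,$$ so that $J_{z_j}=P_{\mathcal{M}}M_{z_j}|_{\mathcal{M}^\perp}:\mathcal{M}^\perp\to\mathcal{M}$. Let $\mathcal{M}\subset\mathcal{H}^2$ be a nonzero submodule. Then $\mathcal{M}$ is of infinite codimension in $\mathcal{H}^2$ if and only if $$\operatorname{rank}(J_{z_1})+\cdots+\operatorname{rank}(J_{z_d})=\infty .$$ -/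

import Mathlib

open scoped ENNReal

noncomputable section

namespace DruryArveson

/-- The open unit ball `B_d` of `ℂ^d` (Euclidean norm). -/
abbrev Ball (d : ℕ) : Type := Metric.ball (0 : EuclideanSpace ℂ (Fin d)) 1

/-- The monomial `z^I = ∏ z_j ^ I_j`. -/
def monom {d : ℕ} (I : Fin d → ℕ) (z : EuclideanSpace ℂ (Fin d)) : ℂ := ∏ j, z j ^ I j

/-- The multinomial coefficient `|I|! / (I_1! ⋯ I_d!)`. -/
def mult {d : ℕ} (I : Fin d → ℕ) : ℕ := Nat.multinomial Finset.univ I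

/-- The functional Hilbert space `H²` over the unit ball `B_d` with reproducing kernel
`K(z, w) = 1 / (1 - z_1 conj(w_1) - ⋯ - z_d conj(w_d))`.  An element is stored as its
square-summable family of coefficients `a` in the orthonormal basis
`e_I = (|I|! / I!)^{1/2} z^I`; the function on `B_d` that it represents is
`z ↦ ∑_I a_I (|I|! / I!)^{1/2} z^I`, see `HTwo.apply_eq_tsum` below.  That this is the
Hilbert space of functions with kernel `K` is the instance `HTwo.instRKHS` together with
`HTwo.kernel_eq` below. -/
def HTwo (d : ℕ) : Type := lp (fun _ : Fin d → ℕ => ℂ) 2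

namespace HTwo

instance (d : ℕ) : NormedAddCommGroup (HTwo d) :=
  inferInstanceAs (NormedAddCommGroup (lp (fun _ : Fin d → ℕ => ℂ) 2))

instance (d : ℕ) : InnerProductSpace ℂ (HTwo d) :=
  inferInstanceAs (InnerProductSpace ℂ (lp (fun _ : Fin d → ℕ => ℂ) 2))

instance (d : ℕ) : CompleteSpace (HTwo d) :=
  inferInstanceAs (CompleteSpace (lp (fun _ : Fin d → ℕ => ℂ) 2))

variable {d : ℕ}

/-- The coefficients of an element of `H²` in the orthonormal basis `e_I`. -/
def coeff (f : HTwo d) (I : Fin d → ℕ) : ℂ := (show lp (fun _ : Fin d → ℕ => ℂ) 2 from f) I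

lemma hasSum_inner (f g : HTwo d) :
    HasSum (fun I => inner ℂ (coeff f I) (coeff g I)) (inner ℂ f g) :=
  lp.hasSum_inner (G := fun _ : Fin d → ℕ => ℂ) f g

lemma ext_coeff {f g : HTwo d} (h : ∀ I, coeff f I = coeff g I) : f = g :=
  lp.ext (E := fun _ : Fin d → ℕ => ℂ) (p := 2) (funext h)

lemma memlp_two {a : (Fin d → ℕ) → ℂ} (h : Summable fun I => ‖a I‖ ^ 2) :
    Memℓp (E := fun _ : Fin d → ℕ => ℂ) a 2 :=
  memℓp_gen (by simpa using h)

lemma summable_coeff_sq (f : HTwo d) : Summable fun I => ‖coeff f I‖ ^ 2 := by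
  have h := (lp.memℓp (show lp (fun _ : Fin d → ℕ => ℂ) 2 from f)).summable (by simp)
  simpa [coeff] using h

lemma norm_sq_eq (f : HTwo d) : ‖f‖ ^ 2 = ∑' I, ‖coeff f I‖ ^ 2 := by
  have h := lp.norm_rpow_eq_tsum (p := 2) (by simp) (show lp (fun _ : Fin d → ℕ => ℂ) 2 from f)
  simp only [ENNReal.toReal_ofNat, Real.rpow_ofNat] at h
  exact h

/-- The element of `H²` with prescribed square-summable coefficients. -/
def ofCoeff (a : (Fin d → ℕ) → ℂ) (h : Summable fun I => ‖a I‖ ^ 2) : HTwo d :=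
  (⟨a, memlp_two h⟩ : lp (fun _ : Fin d → ℕ => ℂ) 2)

@[simp] lemma coeff_ofCoeff (a : (Fin d → ℕ) → ℂ) (h : Summable fun I => ‖a I‖ ^ 2)
    (I : Fin d → ℕ) : coeff (ofCoeff a h) I = a I := rfl

@[simp] lemma coeff_add (f g : HTwo d) (I : Fin d → ℕ) :
    coeff (f + g) I = coeff f I + coeff g I := rfl

@[simp] lemma coeff_smul (c : ℂ) (f : HTwo d) (I : Fin d → ℕ) :
    coeff (c • f) I = c * coeff f I := rfl

lemma sum_mult (x : Fin d → ℂ) (n : ℕ) :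
    ∑ I ∈ Finset.piAntidiag Finset.univ n, (mult I : ℂ) * ∏ j, x j ^ I j = (∑ j, x j) ^ n :=
  (Finset.sum_pow_eq_sum_piAntidiag Finset.univ x n).symm

lemma tsum_fiber (F : (Fin d → ℕ) → ℂ) (n : ℕ) :
    ∑' I : ((fun I : Fin d → ℕ => ∑ j, I j) ⁻¹' {n}), F I
      = ∑ I ∈ Finset.piAntidiag Finset.univ n, F I := by
  have : ((fun I : Fin d → ℕ => ∑ j, I j) ⁻¹' {n}) =
      ((Finset.piAntidiag Finset.univ n : Finset (Fin d → ℕ)) : Set (Fin d → ℕ)) := by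
    ext I; simp
  rw [this, Finset.tsum_subtype']

lemma summable_mult {x : Fin d → ℝ} (hx : ∀ j, 0 ≤ x j) (h1 : ∑ j, x j < 1) :
    Summable fun I : Fin d → ℕ => (mult I : ℝ) * ∏ j, x j ^ I j := by
  have h0 : 0 ≤ ∑ j, x j := Finset.sum_nonneg fun j _ => hx j
  have hnn : ∀ I : Fin d → ℕ, 0 ≤ (mult I : ℝ) * ∏ j, x j ^ I j := fun I =>
    mul_nonneg (Nat.cast_nonneg _) (Finset.prod_nonneg fun j _ => pow_nonneg (hx j) _)
  refine summable_of_sum_le (c := (1 - ∑ j, x j)⁻¹) hnn fun s => ?_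
  have hmaps : ∀ I ∈ s, (∑ j, I j) ∈ Finset.range (s.sup (fun I => ∑ j, I j) + 1) := fun I hI =>
    Finset.mem_range.2 (Nat.lt_succ_of_le (Finset.le_sup (f := fun I : Fin d → ℕ => ∑ j, I j) hI))
  rw [← Finset.sum_fiberwise_of_maps_to hmaps]
  calc _ ≤ ∑ n ∈ Finset.range (s.sup (fun I => ∑ j, I j) + 1), (∑ j, x j) ^ n := by
        refine Finset.sum_le_sum fun n _ => ?_
        rw [Finset.sum_pow_eq_sum_piAntidiag]
        refine Finset.sum_le_sum_of_subset_of_nonneg (fun I hI => ?_) fun I _ _ => hnn I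
        simpa using (Finset.mem_filter.1 hI).2
    _ ≤ ∑' n, (∑ j, x j) ^ n :=
        (summable_geometric_of_lt_one h0 h1).sum_le_tsum _ fun n _ => pow_nonneg h0 n
    _ = _ := tsum_geometric_of_lt_one h0 h1

lemma sum_normSq_lt_one (z : Ball d) : ∑ j, ‖z.1 j‖ ^ 2 < 1 := by
  have h : ‖z.1‖ < 1 := mem_ball_zero_iff.1 z.2
  rw [← EuclideanSpace.norm_sq_eq]
  nlinarith [norm_nonneg z.1]

/-- The coefficients `(|I|! / I!)^{1/2} conj(z^I)` of the kernel function at `z`. -/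
def kerCoeff (z : Ball d) (I : Fin d → ℕ) : ℂ :=
  (Real.sqrt (mult I) : ℂ) * (starRingEnd ℂ) (monom I z.1)

lemma summable_kerCoeff (z : Ball d) : Summable fun I => ‖kerCoeff z I‖ ^ 2 := by
  refine (summable_mult (x := fun j => ‖z.1 j‖ ^ 2) (fun j => by positivity)
    (sum_normSq_lt_one z)).congr fun I => ?_
  simp only [kerCoeff, monom, norm_mul, Complex.norm_real, RCLike.norm_conj, mul_pow,
    norm_prod, norm_pow, Real.norm_eq_abs, sq_abs, Real.sq_sqrt (Nat.cast_nonneg (mult I))]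
  congr 1
  rw [← Finset.prod_pow]
  exact Finset.prod_congr rfl fun j _ => by rw [← pow_mul, ← pow_mul, mul_comm]

/-- The kernel function at `z`, as an element of `H²`. -/
def kerVec (z : Ball d) : HTwo d := ofCoeff (kerCoeff z) (summable_kerCoeff z)

/-- Evaluation at the points of the ball. -/
def toFunCLM (d : ℕ) : HTwo d →L[ℂ] (Ball d → ℂ) :=
  ContinuousLinearMap.pi fun z => innerSL ℂ (kerVec z)

lemma toFunCLM_hasSum (f : HTwo d) (z : Ball d) :
    HasSum (fun I => coeff f I * ((Real.sqrt (mult I) : ℂ) * monom I z.1)) (toFunCLM d f z) := by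
  have h := hasSum_inner (kerVec z) f
  have h2 : toFunCLM d f z = inner ℂ (kerVec z) f := rfl
  rw [h2]
  convert h using 2 with I
  simp [kerVec, kerCoeff, RCLike.inner_apply]

lemma monom_smul (I : Fin d → ℕ) (c : ℂ) (z : EuclideanSpace ℂ (Fin d)) :
    monom I (c • z) = c ^ (∑ j, I j) * monom I z := by
  simp [monom, mul_pow, Finset.prod_mul_distrib, Finset.prod_pow_eq_pow_sum]

lemma mult_pos (I : Fin d → ℕ) : 0 < mult I := Nat.multinomial_pos _ _

lemma toFunCLM_injective (d : ℕ) : Function.Injective (toFunCLM d) := by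
  refine (injective_iff_map_eq_zero _).2 fun f hf => ?_
  set c : (Fin d → ℕ) → ℂ := fun I => coeff f I * (Real.sqrt (mult I) : ℂ) with hc
  -- the homogeneous parts vanish on the ball
  have key : ∀ (z : Ball d) (n : ℕ),
      ∑ I ∈ Finset.piAntidiag Finset.univ n, c I * monom I z.1 = 0 := by
    intro z
    set p : ℕ → ℂ := fun n => ∑ I ∈ Finset.piAntidiag Finset.univ n, c I * monom I z.1 with hp
    have hs : ∀ t : ℂ, ‖t‖ < 1 → HasSum (fun n => t ^ n * p n) 0 := by
      intro t ht
      have hz : ‖z.1‖ < 1 := mem_ball_zero_iff.1 z.2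
      have hmem : t • z.1 ∈ Metric.ball (0 : EuclideanSpace ℂ (Fin d)) 1 := by
        rw [mem_ball_zero_iff, norm_smul]
        nlinarith [norm_nonneg z.1, norm_nonneg t]
      have h := toFunCLM_hasSum f ⟨t • z.1, hmem⟩
      rw [hf] at h
      have h2 := h.tsum_fiberwise (fun I : Fin d → ℕ => ∑ j, I j)
      refine HasSum.congr_fun h2 fun n => ?_
      rw [tsum_fiber (fun I => coeff f I * ((Real.sqrt (mult I) : ℂ) * monom I (t • z.1))) n,
        hp, Finset.mul_sum]
      refine Finset.sum_congr rfl fun I hI => ?_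
      have : ∑ j, I j = n := by simpa using hI
      rw [monom_smul, this, hc]; ring
    have hps : HasFPowerSeriesAt (0 : ℂ → ℂ) (FormalMultilinearSeries.ofScalars ℂ p) 0 := by
      rw [hasFPowerSeriesAt_iff]
      filter_upwards [Metric.ball_mem_nhds (0 : ℂ) one_pos] with t ht
      simpa [FormalMultilinearSeries.coeff_ofScalars] using hs t (mem_ball_zero_iff.1 ht)
    intro n
    have h0 := congrArg (fun q => FormalMultilinearSeries.coeff q n) hps.eq_zero
    rw [FormalMultilinearSeries.coeff_ofScalars] at h0
    exact h0
  refine ext_coeff fun I => ?_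
  set n := ∑ j, I j with hn
  set P : MvPolynomial (Fin d) ℂ := ∑ J ∈ Finset.piAntidiag Finset.univ n,
    MvPolynomial.monomial (Finsupp.equivFunOnFinite.symm J) (c J) with hP
  have hP0 : P = 0 := by
    refine MvPolynomial.funext fun w => ?_
    set z : EuclideanSpace ℂ (Fin d) := WithLp.toLp 2 w with hz
    set t : ℝ := (1 + ‖z‖)⁻¹ with ht
    have htpos : 0 < t := by positivity
    have hmem : (t : ℂ) • z ∈ Metric.ball (0 : EuclideanSpace ℂ (Fin d)) 1 := by
      rw [mem_ball_zero_iff, norm_smul, Complex.norm_real, Real.norm_of_nonneg htpos.le, ht,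
        inv_mul_lt_iff₀ (by positivity)]
      linarith
    have h := key ⟨_, hmem⟩ n
    have h1 : ∑ J ∈ Finset.piAntidiag Finset.univ n, c J * monom J ((t : ℂ) • z)
        = (t : ℂ) ^ n * ∑ J ∈ Finset.piAntidiag Finset.univ n, c J * monom J z := by
      rw [Finset.mul_sum]
      refine Finset.sum_congr rfl fun J hJ => ?_
      have : ∑ j, J j = n := by simpa using hJ
      rw [monom_smul, this]; ring
    rw [h1] at h
    have h2 := (mul_eq_zero.1 h).resolve_left
      (pow_ne_zero _ (Complex.ofReal_ne_zero.2 htpos.ne'))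
    simp only [hP, map_sum, map_zero, MvPolynomial.eval_monomial]
    rw [← h2]
    refine Finset.sum_congr rfl fun J _ => ?_
    congr 1
    rw [Finsupp.prod_fintype _ _ (by simp)]
    rfl
  have h3 : MvPolynomial.coeff (Finsupp.equivFunOnFinite.symm I) P = c I := by
    simp only [hP, MvPolynomial.coeff_sum, MvPolynomial.coeff_monomial,
      EmbeddingLike.apply_eq_iff_eq]
    rw [Finset.sum_ite_eq', if_pos]
    simp [hn]
  rw [hP0, MvPolynomial.coeff_zero] at h3
  have h4 : (Real.sqrt (mult I) : ℂ) ≠ 0 :=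
    Complex.ofReal_ne_zero.2 (Real.sqrt_ne_zero'.2 (Nat.cast_pos.2 (mult_pos I)))
  exact (mul_eq_zero.1 h3.symm).resolve_right h4

instance instRKHS (d : ℕ) : RKHS ℂ (HTwo d) (Ball d) ℂ where
  coeCLM := toFunCLM d
  coeCLM_injective := toFunCLM_injective d

/-- The function represented by `f ∈ H²`. -/
theorem hasSum_apply (f : HTwo d) (z : Ball d) :
    HasSum (fun I => coeff f I * ((Real.sqrt (mult I) : ℂ) * monom I z.1)) (f z) :=
  toFunCLM_hasSum f z

theorem apply_eq_tsum (f : HTwo d) (z : Ball d) :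
    f z = ∑' I, coeff f I * ((Real.sqrt (mult I) : ℂ) * monom I z.1) :=
  (hasSum_apply f z).tsum_eq.symm

lemma apply_eq_inner (f : HTwo d) (z : Ball d) : f z = inner ℂ (kerVec z) f := rfl

/-- The reproducing kernel of `H²` is `K(z, w) = 1 / (1 - ∑ z_j conj(w_j))`. -/
theorem kernel_eq (z w : Ball d) :
    RKHS.kernel (HTwo d) z w 1 = 1 / (1 - ∑ j, z.1 j * (starRingEnd ℂ) (w.1 j)) := by
  have hker : RKHS.kerFun (HTwo d) w 1 = kerVec w := by
    refine ext_inner_right ℂ fun f => ?_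
    rw [RKHS.kerFun_inner, ← apply_eq_inner]
    simp
  rw [← RKHS.kerFun_apply, hker]
  have h := hasSum_apply (kerVec w) z
  have h2 := h.tsum_fiberwise (fun I : Fin d → ℕ => ∑ j, I j)
  set x : Fin d → ℂ := fun j => z.1 j * (starRingEnd ℂ) (w.1 j) with hx
  have hlt : ‖∑ j, x j‖ < 1 := by
    have h1 : ‖z.1‖ < 1 := mem_ball_zero_iff.1 z.2
    have h2 : ‖w.1‖ < 1 := mem_ball_zero_iff.1 w.2
    have h3 : ∑ j, x j = inner ℂ w.1 z.1 := by simp [PiLp.inner_apply, hx]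
    rw [h3]
    refine (norm_inner_le_norm _ _).trans_lt ?_
    nlinarith [norm_nonneg z.1, norm_nonneg w.1]
  have h4 : HasSum (fun n => (∑ j, x j) ^ n) (kerVec w z) := by
    refine HasSum.congr_fun h2 fun n => ?_
    rw [tsum_fiber (fun I => coeff (kerVec w) I * ((Real.sqrt (mult I) : ℂ) * monom I z.1)) n,
      ← sum_mult]
    refine Finset.sum_congr rfl fun I _ => ?_
    have hsq : (Real.sqrt (mult I) : ℂ) * (Real.sqrt (mult I) : ℂ) = mult I := by
      rw [← Complex.ofReal_mul, Real.mul_self_sqrt (Nat.cast_nonneg _), Complex.ofReal_natCast]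
    rw [← hsq]
    simp only [kerVec, coeff_ofCoeff, kerCoeff, monom, hx, mul_pow, Finset.prod_mul_distrib,
      map_prod, map_pow]
    ring
  rw [one_div]
  exact h4.unique (hasSum_geometric_of_norm_lt_one hlt)

/-- The coefficients of `z_j f`: since `z_j e_J = ((J_j + 1) / (|J| + 1))^{1/2} e_{J + ε_j}`, the
coefficient at `I` is `(I_j / |I|)^{1/2} a_{I - ε_j}`, which is `0` when `I_j = 0`. -/
def shiftCoeff (j : Fin d) (f : HTwo d) (I : Fin d → ℕ) : ℂ :=
  (Real.sqrt ((I j : ℝ) / ((∑ i, I i : ℕ) : ℝ)) : ℂ) * coeff f (I - Pi.single j 1)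

lemma shift_injective (j : Fin d) :
    Function.Injective fun J : Fin d → ℕ => J + Pi.single j 1 := add_left_injective _

lemma shiftCoeff_of_notMem (j : Fin d) (f : HTwo d) (I : Fin d → ℕ)
    (hI : I ∉ Set.range fun J : Fin d → ℕ => J + Pi.single j 1) : shiftCoeff j f I = 0 := by
  have h0 : I j = 0 := by
    by_contra h
    refine hI ⟨I - Pi.single j 1, funext fun i => ?_⟩
    by_cases hi : i = j
    · subst hi; simp; omega
    · simp [Pi.single_eq_of_ne hi]
  simp [shiftCoeff, h0]

lemma sum_add_single (J : Fin d → ℕ) (j : Fin d) :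
    ∑ i, (J + Pi.single j 1 : Fin d → ℕ) i = (∑ i, J i) + 1 := by
  simp [Finset.sum_add_distrib]

lemma shiftCoeff_add (j : Fin d) (f : HTwo d) (J : Fin d → ℕ) :
    shiftCoeff j f (J + Pi.single j 1) =
      (Real.sqrt (((J j : ℝ) + 1) / ((∑ i, J i : ℕ) + 1)) : ℂ) * coeff f J := by
  rw [shiftCoeff, sum_add_single, add_tsub_cancel_right]
  simp

lemma norm_shiftCoeff_add_le (j : Fin d) (f : HTwo d) (J : Fin d → ℕ) :
    ‖shiftCoeff j f (J + Pi.single j 1)‖ ^ 2 ≤ ‖coeff f J‖ ^ 2 := by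
  rw [shiftCoeff_add, norm_mul, Complex.norm_real, Real.norm_of_nonneg (Real.sqrt_nonneg _)]
  have h1 : Real.sqrt (((J j : ℝ) + 1) / ((∑ i, J i : ℕ) + 1)) ≤ 1 := by
    rw [Real.sqrt_le_one]
    rw [div_le_one (by positivity)]
    have : J j ≤ ∑ i, J i := Finset.single_le_sum (fun i _ => Nat.zero_le (J i)) (Finset.mem_univ j)
    have : (J j : ℝ) ≤ ((∑ i, J i : ℕ) : ℝ) := Nat.cast_le.2 this
    linarith
  gcongr
  exact mul_le_of_le_one_left (norm_nonneg _) h1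

lemma summable_shiftCoeff (j : Fin d) (f : HTwo d) :
    Summable fun I => ‖shiftCoeff j f I‖ ^ 2 := by
  rw [← (shift_injective j).summable_iff fun I hI => by simp [shiftCoeff_of_notMem j f I hI]]
  exact (summable_coeff_sq f).of_nonneg_of_le (fun J => sq_nonneg _)
    fun J => norm_shiftCoeff_add_le j f J

/-- The bounded operator `M_{z_j}` of multiplication by the coordinate function `z_j` on `H²`
(see `Mz_apply`). -/
def Mz (j : Fin d) : HTwo d →L[ℂ] HTwo d :=
  LinearMap.mkContinuous
    { toFun := fun f => ofCoeff (shiftCoeff j f) (summable_shiftCoeff j f)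
      map_add' := fun f g => ext_coeff fun I => by simp [shiftCoeff, mul_add]
      map_smul' := fun c f => ext_coeff fun I => by simp [shiftCoeff, mul_left_comm] }
    1 fun f => by
      refine (pow_le_pow_iff_left₀ (norm_nonneg _) (by rw [one_mul]; exact norm_nonneg _)
        two_ne_zero).1 ?_
      rw [one_mul, norm_sq_eq, norm_sq_eq]
      simp only [LinearMap.coe_mk, AddHom.coe_mk, coeff_ofCoeff]
      rw [← (shift_injective j).tsum_eq]
      · refine Summable.tsum_le_tsum (fun J => norm_shiftCoeff_add_le j f J) ?_
          (summable_coeff_sq f)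
        exact (summable_shiftCoeff j f).comp_injective (shift_injective j)
      · intro I hI
        by_contra h
        exact hI (by simp [shiftCoeff_of_notMem j f I h])

@[simp] lemma coeff_Mz (j : Fin d) (f : HTwo d) (I : Fin d → ℕ) :
    coeff (Mz j f) I = shiftCoeff j f I := rfl

lemma mult_add_single (J : Fin d → ℕ) (j : Fin d) :
    (J j + 1) * mult (J + Pi.single j 1) = ((∑ i, J i) + 1) * mult J := by
  have h1 := Nat.multinomial_spec Finset.univ (J + Pi.single j 1)
  have h2 := Nat.multinomial_spec Finset.univ J
  rw [sum_add_single, Nat.factorial_succ, ← h2] at h1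
  have h3 : ∏ i, ((J + Pi.single j 1 : Fin d → ℕ) i).factorial = (J j + 1) * ∏ i, (J i).factorial := by
    rw [← Finset.mul_prod_erase _ _ (Finset.mem_univ j),
      ← Finset.mul_prod_erase _ (fun i => (J i).factorial) (Finset.mem_univ j), ← mul_assoc]
    congr 1
    · simp [Nat.factorial_succ]
    · refine Finset.prod_congr rfl fun i hi => ?_
      simp [Pi.single_eq_of_ne (Finset.ne_of_mem_erase hi)]
  rw [h3] at h1
  have hpos : 0 < ∏ i, (J i).factorial := Finset.prod_pos fun i _ => Nat.factorial_pos _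
  refine Nat.eq_of_mul_eq_mul_left hpos ?_
  simp only [mult]
  linarith

lemma monom_add_single (J : Fin d → ℕ) (j : Fin d) (z : EuclideanSpace ℂ (Fin d)) :
    monom (J + Pi.single j 1) z = z j * monom J z := by
  simp only [monom, Pi.add_apply, pow_add, Finset.prod_mul_distrib]
  rw [mul_comm, Finset.prod_eq_single j (fun i _ hi => by simp [Pi.single_eq_of_ne hi]) (by simp)]
  simp

/-- `M_{z_j}` is multiplication by `z_j`. -/
theorem Mz_apply (j : Fin d) (f : HTwo d) (z : Ball d) : Mz j f z = z.1 j * f z := by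
  have h := hasSum_apply (Mz j f) z
  rw [← (shift_injective j).hasSum_iff fun I hI => by simp [shiftCoeff_of_notMem j f I hI]] at h
  refine h.unique ?_
  refine HasSum.congr_fun ((hasSum_apply f z).mul_left (z.1 j)) fun J => ?_
  have hs : Real.sqrt (((J j : ℝ) + 1) / ((∑ i, J i : ℕ) + 1)) *
      Real.sqrt (mult (J + Pi.single j 1)) = Real.sqrt (mult J) := by
    rw [← Real.sqrt_mul (by positivity)]
    congr 1
    have h1 : ((J j : ℝ) + 1) * mult (J + Pi.single j 1) = ((∑ i, J i : ℕ) + 1) * mult J := by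
      exact_mod_cast mult_add_single J j
    rw [div_mul_eq_mul_div, h1, mul_div_cancel_left₀ _ (by positivity)]
  simp only [Function.comp_apply, coeff_Mz, shiftCoeff_add, monom_add_single]
  rw [← hs, Complex.ofReal_mul]
  ring

/-- The jumping operator `J_{z_j} : Mᗮ → M`, the upper right entry `P_M M_{z_j}|_{Mᗮ}` of the
operator matrix of `M_{z_j}` with respect to `H² = M ⊕ Mᗮ`. -/
def jump (M : ClosedSubmodule ℂ (HTwo d)) (j : Fin d) :
    M.toSubmoduleᗮ →L[ℂ] M.toSubmodule :=
  M.toSubmodule.orthogonalProjectionOnto ∘L Mz j ∘L M.toSubmoduleᗮ.subtypeL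

end HTwo
end DruryArveson
end

/-!
The easy half is that operators on a finite-dimensional space have finite rank.  For the other half
let `P` be the projection onto `M` and suppose that all jumping operators, that is, all corners
`P M_{z_j} (1 - P)`, have finite rank.

*`M` contains a nonzero homogeneous polynomial* (`HTwo.exists_homog_mem`).  As `M` is invariant, the
self-adjoint operator `A = ∑_j M_{z_j}^* M_{z_j}` (`HTwo.gram`) commutes with `P` up to an operator
`R` of finite rank `n`.  On homogeneous polynomials of degree `m` it is the scalar
`(m + d) / (m + 1)`; since `d ≥ 2` these scalars are distinct, so the eigenspaces of `A` are the
spaces of homogeneous polynomials.  (For `d = 1` the operator `A` is the identity and the theorem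
fails.)  Let `f ∈ M` be nonzero with lowest homogeneous component `u`.  The binary forms `q` of
degree `n` have dimension `n + 1 > n`, so `R (q u) = 0` for some `q ≠ 0`.  Then `P (q u)` is an
eigenvector of `A`, hence a homogeneous polynomial in `M`; it is not zero, because the inner product
of `q u` with `q f ∈ M` is `‖q u‖² ≠ 0`.

*A nonzero polynomial `p ∈ M` makes `Mᗮ` finite-dimensional* (`HTwo.finiteDimensional_orthogonal`).
Operators whose corner has finite rank form an algebra, so `P p(M_z) (1 - P)` has finite rank.  But
`p` multiplies all of `H²` into `M` (`HTwo.mul_mem_of_mem`), so this corner is multiplication by `p`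
on `Mᗮ`, which is injective (`HTwo.eq_zero_of_eval_mul_eq_zero`).
-/

namespace DruryArveson

/-! ### Operators of finite rank and their corners -/

section FiniteRank

variable {E : Type*} [NormedAddCommGroup E] [InnerProductSpace ℂ E]

/-- A bounded operator has finite rank if its range is finite-dimensional. -/
def FiniteRank (T : E →L[ℂ] E) : Prop :=
  FiniteDimensional ℂ (LinearMap.range T.toLinearMap)

lemma FiniteRank.of_mem {T : E →L[ℂ] E} (F : Submodule ℂ E) [FiniteDimensional ℂ F]
    (h : ∀ x, T x ∈ F) : FiniteRank T := by
  refine Submodule.finiteDimensional_of_le (S₂ := F) ?_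
  rintro _ ⟨x, rfl⟩
  exact h x

lemma finiteRank_zero : FiniteRank (0 : E →L[ℂ] E) :=
  FiniteRank.of_mem ⊥ fun x => by simp

lemma FiniteRank.add {S T : E →L[ℂ] E} (hS : FiniteRank S) (hT : FiniteRank T) :
    FiniteRank (S + T) := by
  have := hS
  have := hT
  unfold FiniteRank at *
  exact FiniteRank.of_mem (LinearMap.range S.toLinearMap ⊔ LinearMap.range T.toLinearMap)
    fun x => Submodule.add_mem_sup ⟨x, rfl⟩ ⟨x, rfl⟩

lemma FiniteRank.mul_left {T : E →L[ℂ] E} (hT : FiniteRank T) (S : E →L[ℂ] E) :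
    FiniteRank (S * T) := by
  unfold FiniteRank at hT
  exact FiniteRank.of_mem ((LinearMap.range T.toLinearMap).map S.toLinearMap)
    fun x => ⟨T x, ⟨x, rfl⟩, rfl⟩

lemma FiniteRank.mul_right {T : E →L[ℂ] E} (hT : FiniteRank T) (S : E →L[ℂ] E) :
    FiniteRank (T * S) := by
  unfold FiniteRank at hT
  exact FiniteRank.of_mem (LinearMap.range T.toLinearMap) fun x => ⟨S x, rfl⟩

lemma FiniteRank.neg {T : E →L[ℂ] E} (hT : FiniteRank T) : FiniteRank (-T) := by
  simpa using hT.mul_left (-1)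

/-- The range of the adjoint is the image of the range `F` of `T` under `star T`, since `star T` kills
`Fᗮ`. -/
lemma FiniteRank.adjoint [CompleteSpace E] {T : E →L[ℂ] E} (hT : FiniteRank T) :
    FiniteRank (star T) := by
  unfold FiniteRank at hT
  set F := LinearMap.range T.toLinearMap
  refine FiniteRank.of_mem (F.map (star T).toLinearMap) fun x => ?_
  refine ⟨F.starProjection x, F.starProjection_apply_mem x, ?_⟩
  refine ext_inner_left ℂ fun y => ?_
  change inner ℂ y (ContinuousLinearMap.adjoint T _) = inner ℂ y (ContinuousLinearMap.adjoint T _)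
  rw [ContinuousLinearMap.adjoint_inner_right, ContinuousLinearMap.adjoint_inner_right,
    ← sub_eq_zero, ← inner_sub_right, ← neg_sub, inner_neg_right, neg_eq_zero]
  exact (F.sub_starProjection_mem_orthogonal x) (T y) ⟨y, rfl⟩

variable (K : Submodule ℂ E) [K.HasOrthogonalProjection]

/-- The operators `T` whose corner `P_K T P_{Kᗮ}` has finite rank. -/
def FiniteCorner (T : E →L[ℂ] E) : Prop :=
  FiniteRank (K.starProjection * T * (1 - K.starProjection))

variable {K}

lemma FiniteCorner.add {S T : E →L[ℂ] E} (hS : FiniteCorner K S) (hT : FiniteCorner K T) :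
    FiniteCorner K (S + T) := by
  unfold FiniteCorner at *
  rw [mul_add, add_mul]
  exact FiniteRank.add hS hT

lemma FiniteCorner.mul {S T : E →L[ℂ] E} (hS : FiniteCorner K S) (hT : FiniteCorner K T) :
    FiniteCorner K (S * T) := by
  unfold FiniteCorner at *
  set P := K.starProjection
  have h : P * (S * T) * (1 - P) = P * S * (P * T * (1 - P)) + P * S * (1 - P) * (T * (1 - P)) := by
    noncomm_ring
  rw [h]
  exact (hT.mul_left _).add (hS.mul_right _)

lemma finiteCorner_algebraMap (c : ℂ) : FiniteCorner K (algebraMap ℂ (E →L[ℂ] E) c) := by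
  have h : K.starProjection * algebraMap ℂ (E →L[ℂ] E) c * (1 - K.starProjection) = 0 := by
    rw [← Algebra.commutes c, mul_assoc, mul_sub, mul_one, K.isIdempotentElem_starProjection.eq,
      sub_self, mul_zero]
  unfold FiniteCorner
  rw [h]
  exact finiteRank_zero

lemma FiniteCorner.sum {ι : Type*} (s : Finset ι) {T : ι → E →L[ℂ] E}
    (h : ∀ i ∈ s, FiniteCorner K (T i)) : FiniteCorner K (∑ i ∈ s, T i) :=
  Finset.sum_induction _ _ (fun _ _ => FiniteCorner.add)
    (by simpa using finiteCorner_algebraMap (K := K) 0) h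

variable [CompleteSpace E]

/-- The opposite corner of an operator leaving `K` invariant vanishes. -/
lemma FiniteCorner.star_of_invariant {T : E →L[ℂ] E} (h : ∀ f ∈ K, T f ∈ K) :
    FiniteCorner K (star T) := by
  have h0 : (1 - K.starProjection) * T * K.starProjection = 0 := by
    ext f
    have hf : T (K.starProjection f) ∈ K := h _ (K.starProjection_apply_mem f)
    simp [K.starProjection_eq_self_iff.2 hf]
  have h1 := congrArg star h0
  have hP : star K.starProjection = K.starProjection := isSelfAdjoint_starProjection K
  rw [star_mul, star_mul, star_sub, star_one, star_zero, hP, ← mul_assoc] at h1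
  unfold FiniteCorner
  rw [h1]
  exact finiteRank_zero

/-- A self-adjoint operator with one corner of finite rank commutes with `P_K` up to an operator
of finite rank. -/
lemma FiniteCorner.finiteRank_commutator {T : E →L[ℂ] E} (hT : FiniteCorner K T)
    (hs : IsSelfAdjoint T) : FiniteRank (T * K.starProjection - K.starProjection * T) := by
  have hP : star K.starProjection = K.starProjection := isSelfAdjoint_starProjection K
  have h1 : FiniteRank ((1 - K.starProjection) * T * K.starProjection) := by
    have := FiniteRank.adjoint hT
    rwa [star_mul, star_mul, star_sub, star_one, hP, hs.star_eq, ← mul_assoc] at this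
  have h2 : T * K.starProjection - K.starProjection * T =
      (1 - K.starProjection) * T * K.starProjection
        + -(K.starProjection * T * (1 - K.starProjection)) := by
    noncomm_ring
  rw [h2]
  exact h1.add (FiniteRank.neg hT)

end FiniteRank

namespace HTwo

variable {d : ℕ}

/-! ### Homogeneous elements and the operator `∑ M_{z_j}^* M_{z_j}` -/

/-- The space of homogeneous polynomials of degree `n`, as a subspace of `H²`. -/
def homog (d n : ℕ) : Submodule ℂ (HTwo d) where
  carrier := {f | ∀ I : Fin d → ℕ, ∑ j, I j ≠ n → coeff f I = 0}
  add_mem' hf hg I hI := by rw [coeff_add, hf I hI, hg I hI, add_zero]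
  zero_mem' _ _ := rfl
  smul_mem' c f hf I hI := by rw [coeff_smul, hf I hI, mul_zero]

/-- The functions in `H²` vanishing at the origin to order at least `n`. -/
def vanishing (d n : ℕ) : Submodule ℂ (HTwo d) where
  carrier := {f | ∀ I : Fin d → ℕ, ∑ j, I j < n → coeff f I = 0}
  add_mem' hf hg I hI := by rw [coeff_add, hf I hI, hg I hI, add_zero]
  zero_mem' _ _ := rfl
  smul_mem' c f hf I hI := by rw [coeff_smul, hf I hI, mul_zero]

lemma inner_eq_zero_of_mem_vanishing_of_mem_homog {n : ℕ} {f g : HTwo d}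
    (hf : f ∈ vanishing d (n + 1)) (hg : g ∈ homog d n) : inner ℂ f g = 0 := by
  refine (hasSum_inner f g).unique ?_
  convert hasSum_zero with I
  by_cases h : ∑ j, I j = n
  · rw [hf I (by omega), inner_zero_left]
  · rw [hg I h, inner_zero_right]

lemma shiftCoeff_eq_zero {j : Fin d} {f : HTwo d} {I : Fin d → ℕ}
    (h : ∀ J : Fin d → ℕ, J + Pi.single j 1 = I → coeff f J = 0) : shiftCoeff j f I = 0 := by
  by_cases hI : I ∈ Set.range fun J : Fin d → ℕ => J + Pi.single j 1
  · obtain ⟨J, rfl⟩ := hI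
    simp only
    rw [shiftCoeff_add, h J rfl, mul_zero]
  · exact shiftCoeff_of_notMem j f I hI

lemma Mz_mem_homog (j : Fin d) {n : ℕ} {f : HTwo d} (hf : f ∈ homog d n) :
    Mz j f ∈ homog d (n + 1) := fun I hI => shiftCoeff_eq_zero fun J hJ => hf J (by
  subst hJ; rw [sum_add_single] at hI; omega)

lemma Mz_mem_vanishing (j : Fin d) {n : ℕ} {f : HTwo d} (hf : f ∈ vanishing d n) :
    Mz j f ∈ vanishing d (n + 1) := fun I hI => shiftCoeff_eq_zero fun J hJ => hf J (by
  subst hJ; rw [sum_add_single] at hI; omega)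

lemma Mz_pow_mem_homog (j : Fin d) (k : ℕ) {n : ℕ} {f : HTwo d} (hf : f ∈ homog d n) :
    (Mz j ^ k) f ∈ homog d (n + k) := by
  induction k with
  | zero => simpa using hf
  | succ k ih => rw [pow_succ']; exact Mz_mem_homog j ih

lemma Mz_pow_mem_vanishing (j : Fin d) (k : ℕ) {n : ℕ} {f : HTwo d} (hf : f ∈ vanishing d n) :
    (Mz j ^ k) f ∈ vanishing d (n + k) := by
  induction k with
  | zero => simpa using hf
  | succ k ih => rw [pow_succ']; exact Mz_mem_vanishing j ih

/-- The lowest homogeneous component of a nonzero function. -/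
lemma exists_lowest_component {f : HTwo d} (hf : f ≠ 0) :
    ∃ (l : ℕ) (u : HTwo d), u ≠ 0 ∧ u ∈ homog d l ∧ f - u ∈ vanishing d (l + 1) := by
  classical
  have hex : ∃ l, ∃ I : Fin d → ℕ, ∑ j, I j = l ∧ coeff f I ≠ 0 := by
    by_contra! h
    exact hf (ext_coeff fun I => h _ I rfl)
  obtain ⟨I₀, hI₀, hne⟩ := Nat.find_spec hex
  set l := Nat.find hex
  have hsum : Summable fun I : Fin d → ℕ => ‖if ∑ j, I j = l then coeff f I else 0‖ ^ 2 := by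
    refine (summable_coeff_sq f).of_nonneg_of_le (fun I => sq_nonneg _) fun I => ?_
    split_ifs
    · exact le_rfl
    · simp
  refine ⟨l, ofCoeff _ hsum, fun h => hne ?_, fun I hI => ?_, fun I hI => ?_⟩
  · have := congrArg (fun g => coeff g I₀) h
    simpa [hI₀, show coeff (0 : HTwo d) I₀ = 0 from rfl] using this
  · simp [hI]
  · have hsub : coeff (f - ofCoeff _ hsum) I = coeff f I - if ∑ j, I j = l then coeff f I else 0 :=
      rfl
    rw [hsub]
    split_ifs with h
    · exact sub_self _
    · have := Nat.find_min hex (m := ∑ j, I j) (by change _ < l; omega)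
      push Not at this
      rw [this I rfl, sub_zero]

/-- The vector `e_I` of the orthonormal basis. -/
noncomputable def basisVec (I : Fin d → ℕ) : HTwo d :=
  ofCoeff (Pi.single I 1) (summable_of_ne_finset_zero (s := {I}) fun J hJ => by
    rw [Pi.single_eq_of_ne (by simpa using hJ)]; simp)

lemma coeff_basisVec (I J : Fin d → ℕ) :
    coeff (basisVec I) J = (Pi.single I 1 : (Fin d → ℕ) → ℂ) J := rfl

lemma inner_basisVec (I : Fin d → ℕ) (f : HTwo d) : inner ℂ (basisVec I) f = coeff f I := by
  refine (hasSum_inner _ f).unique ?_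
  have h := hasSum_single (f := fun J => inner ℂ (coeff (basisVec I) J) (coeff f J)) I fun J hJ => by
    rw [coeff_basisVec, Pi.single_eq_of_ne hJ, inner_zero_left]
  simpa [coeff_basisVec] using h

lemma basisVec_apply (I : Fin d → ℕ) (z : Ball d) :
    basisVec I z = (Real.sqrt (mult I) : ℂ) * monom I z.1 := by
  refine (hasSum_apply _ z).unique ?_
  have h := hasSum_single
    (f := fun J => coeff (basisVec I) J * ((Real.sqrt (mult J) : ℂ) * monom J z.1)) I
    fun J hJ => by rw [coeff_basisVec, Pi.single_eq_of_ne hJ, zero_mul]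
  simpa [coeff_basisVec] using h

lemma Mz_basisVec (j : Fin d) (I : Fin d → ℕ) :
    Mz j (basisVec I) =
      (Real.sqrt (((I j : ℝ) + 1) / ((∑ i, I i : ℕ) + 1)) : ℂ) • basisVec (I + Pi.single j 1) := by
  refine ext_coeff fun K => ?_
  rw [coeff_Mz, coeff_smul, coeff_basisVec]
  by_cases hK : K = I + Pi.single j 1
  · subst hK
    rw [shiftCoeff_add, coeff_basisVec, Pi.single_eq_same, Pi.single_eq_same]
  · rw [Pi.single_eq_of_ne hK, mul_zero]
    refine shiftCoeff_eq_zero fun J hJ => ?_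
    rw [coeff_basisVec, Pi.single_eq_of_ne]
    rintro rfl
    exact hK hJ.symm

lemma coeff_star_Mz (j : Fin d) (f : HTwo d) (I : Fin d → ℕ) :
    coeff (star (Mz j) f) I =
      (Real.sqrt (((I j : ℝ) + 1) / ((∑ i, I i : ℕ) + 1)) : ℂ) * coeff f (I + Pi.single j 1) := by
  rw [← inner_basisVec, ContinuousLinearMap.star_eq_adjoint,
    ContinuousLinearMap.adjoint_inner_right, Mz_basisVec, inner_smul_left, inner_basisVec,
    Complex.conj_ofReal]

/-- The operator `∑_j M_{z_j}^* M_{z_j}`.  It acts on homogeneous polynomials of degree `n` as the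
scalar `(n + d) / (n + 1)`, so that for `d ≥ 2` its eigenspaces are the spaces of homogeneous
polynomials. -/
noncomputable def gram (d : ℕ) : HTwo d →L[ℂ] HTwo d := ∑ j : Fin d, star (Mz j) * Mz j

lemma isSelfAdjoint_gram (d : ℕ) : IsSelfAdjoint (gram d) := by
  rw [isSelfAdjoint_iff, gram, star_sum]
  exact Finset.sum_congr rfl fun j _ => by rw [star_mul, star_star]

lemma coeff_gram (f : HTwo d) (I : Fin d → ℕ) :
    coeff (gram d f) I = (((∑ i, I i : ℕ) : ℂ) + d) / (((∑ i, I i : ℕ) : ℂ) + 1) * coeff f I := by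
  have h1 : coeff (gram d f) I = ∑ j, coeff (star (Mz j) (Mz j f)) I := by
    simp only [← inner_basisVec, gram, sum_apply, inner_sum]
    rfl
  have h2 : ∀ j, coeff (star (Mz j) (Mz j f)) I =
      ((I j : ℂ) + 1) / (((∑ i, I i : ℕ) : ℂ) + 1) * coeff f I := fun j => by
    rw [coeff_star_Mz, coeff_Mz, shiftCoeff_add, ← mul_assoc, ← Complex.ofReal_mul,
      Real.mul_self_sqrt (by positivity)]
    push_cast
    rfl
  rw [h1, Finset.sum_congr rfl fun j _ => h2 j, ← Finset.sum_mul, ← Finset.sum_div,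
    Finset.sum_add_distrib]
  simp

lemma gram_apply_of_mem_homog {n : ℕ} {f : HTwo d} (hf : f ∈ homog d n) :
    gram d f = (((n : ℂ) + d) / ((n : ℂ) + 1)) • f := by
  refine ext_coeff fun I => ?_
  rw [coeff_gram, coeff_smul]
  by_cases h : ∑ j, I j = n
  · rw [h]
  · rw [hf I h, mul_zero, mul_zero]

lemma mem_homog_of_gram_apply (hd : 2 ≤ d) {n : ℕ} {f : HTwo d}
    (hf : gram d f = (((n : ℂ) + d) / ((n : ℂ) + 1)) • f) : f ∈ homog d n := by
  intro I hI
  have h := congrArg (fun g => coeff g I) hf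
  simp only [coeff_gram, coeff_smul] at h
  by_contra h0
  have h1 := mul_right_cancel₀ h0 h
  rw [div_eq_div_iff (Nat.cast_add_one_ne_zero _) (Nat.cast_add_one_ne_zero _)] at h1
  norm_cast at h1
  refine hI ?_
  obtain ⟨e, rfl⟩ := Nat.exists_eq_add_of_le hd
  -- the identity `(m + d) (n + 1) = (n + d) (m + 1)` means `(d - 1) (m - n) = 0`
  have h2 : (1 + e) * (∑ i, I i) = (1 + e) * n := by nlinarith
  exact Nat.eq_of_mul_eq_mul_left (by omega) h2

/-! ### Multiplication by polynomials -/

/-- Functions in `H²` are continuous: the explicit kernel makes `z ↦ kerVec z` norm continuous. -/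
lemma continuous_apply (f : HTwo d) : Continuous fun z : Ball d => f z := by
  have hin : ∀ z w : Ball d, inner ℂ (kerVec z) (kerVec w) =
      1 / (1 - ∑ j, z.1 j * (starRingEnd ℂ) (w.1 j)) := fun z w => by
    have hker : RKHS.kerFun (HTwo d) w 1 = kerVec w := by
      refine ext_inner_right ℂ fun f => ?_
      rw [RKHS.kerFun_inner, ← apply_eq_inner]
      simp
    rw [← kernel_eq, ← RKHS.kerFun_apply, hker, apply_eq_inner]
  have hne : ∀ z w : Ball d, 1 - ∑ j, z.1 j * (starRingEnd ℂ) (w.1 j) ≠ 0 := fun z w h => by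
    have h3 : ∑ j, z.1 j * (starRingEnd ℂ) (w.1 j) = inner ℂ w.1 z.1 := by simp [PiLp.inner_apply]
    have h1 : ‖z.1‖ < 1 := mem_ball_zero_iff.1 z.2
    have h2 : ‖w.1‖ < 1 := mem_ball_zero_iff.1 w.2
    have h4 := norm_inner_le_norm (𝕜 := ℂ) w.1 z.1
    rw [← h3, ← sub_eq_zero.1 h, norm_one] at h4
    nlinarith [norm_nonneg z.1, norm_nonneg w.1]
  have hk : Continuous fun z : Ball d => kerVec z := by
    refine continuous_iff_continuousAt.2 fun w => ?_
    rw [ContinuousAt, tendsto_iff_norm_sub_tendsto_zero]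
    have hc : Continuous fun z : Ball d =>
        RCLike.re (inner ℂ (kerVec z - kerVec w) (kerVec z - kerVec w)) := by
      simp only [inner_sub_left, inner_sub_right, hin]
      refine RCLike.continuous_re.comp ?_
      refine ((continuous_const.div ?_ fun z => hne _ _).sub
        (continuous_const.div ?_ fun z => hne _ _)).sub
        ((continuous_const.div ?_ fun z => hne _ _).sub continuous_const) <;> fun_prop
    have h := (Real.continuous_sqrt.comp hc).tendsto w
    simp only [Function.comp_def, ← norm_eq_sqrt_re_inner, sub_self, norm_zero] at h
    exact h
  simp only [apply_eq_inner]
  exact hk.inner continuous_const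

/-- Multiplication by a nonzero polynomial is injective: a polynomial vanishing where a continuous
nonzero function does not vanish is zero. -/
lemma eq_zero_of_eval_mul_eq_zero {p : MvPolynomial (Fin d) ℂ} (hp : p ≠ 0) {f : HTwo d}
    (h : ∀ z : Ball d, MvPolynomial.eval (fun j => z.1 j) p * f z = 0) : f = 0 := by
  by_contra hf
  obtain ⟨z₀, hz₀⟩ : ∃ z, f z ≠ 0 := by
    by_contra! h0
    exact hf (RKHS.ext fun z => by rw [h0 z]; simp)
  have hopen : IsOpen {z : Ball d | f z ≠ 0} := isOpen_ne_fun (continuous_apply f) continuous_const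
  obtain ⟨V, hV, hVeq⟩ := isOpen_induced_iff.1 hopen
  set W : Set (Fin d → ℂ) :=
    (fun x : Fin d → ℂ => (WithLp.toLp 2 x : EuclideanSpace ℂ (Fin d))) ⁻¹'
      (V ∩ Metric.ball 0 1) with hW
  have hWo : IsOpen W := (hV.inter Metric.isOpen_ball).preimage (PiLp.continuous_toLp 2 _)
  have hmem : (fun j => z₀.1 j) ∈ W := by
    have : z₀ ∈ Subtype.val ⁻¹' V := by rw [hVeq]; exact hz₀
    exact ⟨this, z₀.2⟩
  obtain ⟨ε, hε, hball⟩ := Metric.isOpen_iff.1 hWo _ hmem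
  refine hp (MvPolynomial.funext_set (fun j => Metric.ball (z₀.1 j) ε) (fun j => ?_) fun x hx => ?_)
  · exact infinite_of_mem_nhds _ (Metric.ball_mem_nhds _ hε)
  · rw [ball_pi _ hε] at hball
    obtain ⟨hxV, hxB⟩ := hball hx
    have hfx : f ⟨WithLp.toLp 2 x, hxB⟩ ≠ 0 := by
      have : (⟨WithLp.toLp 2 x, hxB⟩ : Ball d) ∈ Subtype.val ⁻¹' V := hxV
      rwa [hVeq] at this
    rw [map_zero]
    exact (mul_eq_zero.1 (h ⟨WithLp.toLp 2 x, hxB⟩)).resolve_right hfx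

lemma Mz_pow_apply (j : Fin d) (k : ℕ) (f : HTwo d) (z : Ball d) :
    (Mz j ^ k) f z = z.1 j ^ k * f z := by
  induction k with
  | zero => simp
  | succ k ih =>
    rw [pow_succ', pow_succ', mul_assoc, ← ih, ← Mz_apply]
    rfl

/-- The algebra of the operators `p(M_{z_1}, …, M_{z_d})`, for `p` a polynomial. -/
noncomputable abbrev polyOps (d : ℕ) : Subalgebra ℂ (HTwo d →L[ℂ] HTwo d) := Algebra.adjoin ℂ (Set.range Mz)

lemma exists_mem_polyOps (p : MvPolynomial (Fin d) ℂ) :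
    ∃ T ∈ polyOps d, ∀ (f : HTwo d) (z : Ball d),
      T f z = MvPolynomial.eval (fun j => z.1 j) p * f z := by
  induction p using MvPolynomial.induction_on with
  | C c => exact ⟨_, (polyOps d).algebraMap_mem c, fun f z => by
      simp [Algebra.algebraMap_eq_smul_one]⟩
  | add p q hp hq =>
    obtain ⟨S, hS, hS'⟩ := hp
    obtain ⟨T, hT, hT'⟩ := hq
    exact ⟨S + T, add_mem hS hT, fun f z => by simp [hS', hT', add_mul]⟩
  | mul_X p j hp =>
    obtain ⟨S, hS, hS'⟩ := hp
    exact ⟨S * Mz j, mul_mem hS (Algebra.subset_adjoin ⟨j, rfl⟩), fun f z => by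
      rw [mul_apply_eq_comp, hS', Mz_apply]; simp [mul_assoc]⟩

lemma polyOps_mem {M : Submodule ℂ (HTwo d)} (hM : ∀ j : Fin d, ∀ f ∈ M, Mz j f ∈ M)
    {T : HTwo d →L[ℂ] HTwo d} (hT : T ∈ polyOps d) : ∀ f ∈ M, T f ∈ M := by
  induction hT using Algebra.adjoin_induction with
  | mem T h => obtain ⟨j, rfl⟩ := h; exact hM j
  | algebraMap c => intro f hf; simpa [Algebra.algebraMap_eq_smul_one] using M.smul_mem c hf
  | add S T _ _ hS hT => exact fun f hf => M.add_mem (hS f hf) (hT f hf)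
  | mul S T _ _ hS hT => exact fun f hf => hS _ (hT f hf)

lemma finiteCorner_of_mem_polyOps {M : Submodule ℂ (HTwo d)} [M.HasOrthogonalProjection]
    (h : ∀ j : Fin d, FiniteCorner M (Mz j)) {T : HTwo d →L[ℂ] HTwo d} (hT : T ∈ polyOps d) :
    FiniteCorner M T := by
  induction hT using Algebra.adjoin_induction with
  | mem T hT => obtain ⟨j, rfl⟩ := hT; exact h j
  | algebraMap c => exact finiteCorner_algebraMap c
  | add S T _ _ hS hT => exact hS.add hT
  | mul S T _ _ hS hT => exact hS.mul hT

lemma exists_polynomial_of_mem_homog {n : ℕ} {v : HTwo d} (hv : v ∈ homog d n) :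
    ∃ p : MvPolynomial (Fin d) ℂ, ∀ z : Ball d, v z = MvPolynomial.eval (fun j => z.1 j) p := by
  refine ⟨∑ I ∈ Finset.piAntidiag Finset.univ n, MvPolynomial.monomial
    (Finsupp.equivFunOnFinite.symm I) (coeff v I * (Real.sqrt (mult I) : ℂ)), fun z => ?_⟩
  refine (hasSum_apply v z).unique ?_
  rw [map_sum]
  have h := hasSum_sum_of_ne_finset_zero (L := .unconditional _) (s := Finset.piAntidiag Finset.univ n)
    (f := fun I => coeff v I * ((Real.sqrt (mult I) : ℂ) * monom I z.1))
    fun I hI => by rw [hv I (by simpa using hI), zero_mul]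
  convert h using 2 with I
  rw [MvPolynomial.eval_monomial, Finsupp.prod_fintype _ _ (by simp), mul_assoc]
  rfl

/-! ### Submodules with jumping operators of finite rank -/

variable {M : Submodule ℂ (HTwo d)}

/-- If the polynomial `v` lies in the closed submodule `M`, then multiplication by `v` maps all of
`H²` into `M`. -/
lemma mul_mem_of_mem [M.HasOrthogonalProjection] (hM : ∀ j : Fin d, ∀ f ∈ M, Mz j f ∈ M)
    {v : HTwo d} (hv : v ∈ M)
    {T : HTwo d →L[ℂ] HTwo d} (hT : ∀ f (z : Ball d), T f z = v z * f z) (f : HTwo d) :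
    T f ∈ M := by
  have hbasis : ∀ I, T (basisVec I) ∈ M := fun I => by
    obtain ⟨S, hS, hS'⟩ := exists_mem_polyOps
      (MvPolynomial.monomial (Finsupp.equivFunOnFinite.symm I) (Real.sqrt (mult I) : ℂ))
    have : T (basisVec I) = S v := RKHS.ext fun z => by
      rw [hT, hS', basisVec_apply, MvPolynomial.eval_monomial,
        Finsupp.prod_fintype _ _ (by simp), mul_comm]
      rfl
    rw [this]
    exact polyOps_mem hM hS v hv
  rw [← M.orthogonal_orthogonal]
  intro g hg
  have h0 : star T g = 0 := ext_coeff fun I => by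
    rw [← inner_basisVec, ContinuousLinearMap.star_eq_adjoint,
      ContinuousLinearMap.adjoint_inner_right]
    exact hg _ (hbasis I)
  rw [ContinuousLinearMap.star_eq_adjoint] at h0
  rw [← ContinuousLinearMap.adjoint_inner_left, h0, inner_zero_left]

/-- A nonzero submodule with jumping operators of finite rank contains a nonzero homogeneous
polynomial.  For `u` the lowest component of an element of `M`, the polynomials `q u`, with `q` a
binary form of degree `n`, form a space of dimension `n + 1`; for `n` the rank of the commutator of
`gram d` and `P_M`, some `q u ≠ 0` is annihilated by it, and `P_M (q u)` is an eigenvector of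
`gram d`. -/
lemma exists_homog_mem [M.HasOrthogonalProjection] (hd : 2 ≤ d)
    (hM : ∀ j : Fin d, ∀ f ∈ M, Mz j f ∈ M)
    (hJ : ∀ j : Fin d, FiniteCorner M (Mz j)) (hne : M ≠ ⊥) :
    ∃ (k : ℕ) (v : HTwo d), v ≠ 0 ∧ v ∈ homog d k ∧ v ∈ M := by
  obtain ⟨f, hf, hf0⟩ := M.exists_mem_ne_zero_of_ne_bot hne
  obtain ⟨l, u, hu0, hu, hfu⟩ := exists_lowest_component hf0
  set P := M.starProjection with hP
  have hA : FiniteRank (gram d * P - P * gram d) := by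
    refine FiniteCorner.finiteRank_commutator ?_ (isSelfAdjoint_gram d)
    exact FiniteCorner.sum _ fun j _ => (FiniteCorner.star_of_invariant (hM j)).mul (hJ j)
  set R := gram d * P - P * gram d with hR
  have : FiniteDimensional ℂ (LinearMap.range R.toLinearMap) := hA
  set n := Module.finrank ℂ (LinearMap.range R.toLinearMap)
  let i₀ : Fin d := ⟨0, by omega⟩
  let i₁ : Fin d := ⟨1, by omega⟩
  have hi : i₀ ≠ i₁ := by simp [i₀, i₁]
  let T : (Fin (n + 1) → ℂ) → HTwo d →L[ℂ] HTwo d := fun c =>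
    ∑ b : Fin (n + 1), c b • (Mz i₀ ^ (n - b) * Mz i₁ ^ (b : ℕ))
  -- a nonzero binary form `q` of degree `n` with `R (q u) = 0`
  obtain ⟨c, hc0, hc⟩ : ∃ c : Fin (n + 1) → ℂ, c ≠ 0 ∧ R (T c u) = 0 := by
    let φ : (Fin (n + 1) → ℂ) →ₗ[ℂ] LinearMap.range R.toLinearMap :=
      { toFun := fun c => ⟨R (T c u), ⟨T c u, rfl⟩⟩
        map_add' := fun a b => by
          ext1
          simp [T, add_smul, Finset.sum_add_distrib]
        map_smul' := fun a b => by
          ext1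
          simp [T, mul_smul, Finset.smul_sum] }
    obtain ⟨c, hc, hc0⟩ := (LinearMap.ker φ).exists_mem_ne_zero_of_ne_bot
      (φ.ker_ne_bot_of_finrank_lt (by simp [n]))
    exact ⟨c, hc0, congrArg Subtype.val (LinearMap.mem_ker.1 hc)⟩
  have hTapply : ∀ g : HTwo d,
      T c g = ∑ b : Fin (n + 1), c b • (Mz i₀ ^ (n - b)) ((Mz i₁ ^ (b : ℕ)) g) := fun g => by simp [T]
  have hTh : T c u ∈ homog d (l + n) := by
    rw [hTapply]
    refine Submodule.sum_mem _ fun b _ => Submodule.smul_mem _ _ ?_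
    have := Mz_pow_mem_homog i₀ (n - b) (Mz_pow_mem_homog i₁ b hu)
    rwa [show l + (b : ℕ) + (n - b) = l + n by omega] at this
  have hTv : T c (f - u) ∈ vanishing d (l + n + 1) := by
    rw [hTapply]
    refine Submodule.sum_mem _ fun b _ => Submodule.smul_mem _ _ ?_
    have := Mz_pow_mem_vanishing i₀ (n - b) (Mz_pow_mem_vanishing i₁ b hfu)
    rwa [show l + 1 + (b : ℕ) + (n - b) = l + n + 1 by omega] at this
  have hTf : T c f ∈ M := by
    refine polyOps_mem hM ?_ f hf
    refine sum_mem fun b _ => Subalgebra.smul_mem _ (mul_mem (pow_mem ?_ _) (pow_mem ?_ _)) _ <;>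
      exact Algebra.subset_adjoin ⟨_, rfl⟩
  have hT0 : T c u ≠ 0 := fun h0 => by
    let q : MvPolynomial (Fin d) ℂ := ∑ b : Fin (n + 1), MvPolynomial.monomial
      (Finsupp.single i₀ (n - b) + Finsupp.single i₁ (b : ℕ)) (c b)
    have hq : q ≠ 0 := fun hq => hc0 (funext fun b => by
      have h := congrArg (MvPolynomial.coeff
        (Finsupp.single i₀ (n - b) + Finsupp.single i₁ (b : ℕ))) hq
      rw [MvPolynomial.coeff_sum, Finset.sum_eq_single b, MvPolynomial.coeff_monomial,
        if_pos rfl] at h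
      · simpa using h
      · intro a _ hab
        rw [MvPolynomial.coeff_monomial, if_neg]
        intro h'
        have := DFunLike.congr_fun h' i₁
        simp [Finsupp.single_eq_of_ne hi.symm] at this
        exact hab (Fin.ext this)
      · simp)
    refine hu0 (eq_zero_of_eval_mul_eq_zero hq fun z => ?_)
    have h1 : T c u z = MvPolynomial.eval (fun j => z.1 j) q * u z := by
      rw [hTapply, apply_eq_inner, inner_sum, map_sum, Finset.sum_mul]
      refine Finset.sum_congr rfl fun b _ => ?_
      rw [inner_smul_right, ← apply_eq_inner, Mz_pow_apply, Mz_pow_apply, MvPolynomial.eval_monomial,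
        Finsupp.prod_add_index' (by simp) (by simp [pow_add]), Finsupp.prod_single_index (by simp),
        Finsupp.prod_single_index (by simp)]
      ring
    rw [← h1, h0]
    simp
  refine ⟨l + n, P (T c u), fun h0 => hT0 ?_, mem_homog_of_gram_apply hd ?_,
    M.starProjection_apply_mem _⟩
  · -- `q f ∈ M` and `q f - q u` is orthogonal to `q u`, so `P_M (q u) = 0` forces `q u = 0`
    have h1 : inner ℂ (T c f) (T c u) = 0 := M.starProjection_apply_eq_zero_iff.1 h0 _ hTf
    have h2 := inner_eq_zero_of_mem_vanishing_of_mem_homog hTv hTh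
    rw [map_sub, inner_sub_left, h1, zero_sub, neg_eq_zero] at h2
    exact inner_self_eq_zero.1 h2
  · have h1 : gram d (P (T c u)) - P (gram d (T c u)) = 0 := hc
    rw [sub_eq_zero.1 h1, gram_apply_of_mem_homog hTh, map_smul]

/-- Multiplication by a nonzero polynomial `p ∈ M` maps `Mᗮ` injectively into `M`, so it is a corner
of an operator in `polyOps d`; as that corner has finite rank, `Mᗮ` is finite-dimensional. -/
theorem finiteDimensional_orthogonal [M.HasOrthogonalProjection] (hd : 2 ≤ d)
    (hM : ∀ j : Fin d, ∀ f ∈ M, Mz j f ∈ M)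
    (hJ : ∀ j : Fin d, FiniteCorner M (Mz j)) (hne : M ≠ ⊥) : FiniteDimensional ℂ Mᗮ := by
  obtain ⟨k, v, hv0, hvk, hvM⟩ := exists_homog_mem hd hM hJ hne
  obtain ⟨p, hp⟩ := exists_polynomial_of_mem_homog hvk
  have hp0 : p ≠ 0 := by
    rintro rfl
    exact hv0 (RKHS.ext fun z => by rw [hp z]; simp)
  obtain ⟨T, hT, hT'⟩ := exists_mem_polyOps p
  have hTM : ∀ f, T f ∈ M := mul_mem_of_mem hM hvM fun f z => by rw [hT', hp]
  have hR := finiteCorner_of_mem_polyOps hJ hT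
  set R := M.starProjection * T * (1 - M.starProjection) with hRdef
  have : FiniteDimensional ℂ (LinearMap.range R.toLinearMap) := hR
  have hRT : ∀ g : Mᗮ, R g = T g := fun g => by
    have h0 : M.starProjection (g : HTwo d) = 0 := M.starProjection_apply_eq_zero_iff.2 g.2
    simp [hRdef, h0, M.starProjection_eq_self_iff.2 (hTM g)]
  refine Module.Finite.of_injective (R.toLinearMap.rangeRestrict ∘ₗ Mᗮ.subtype) ?_
  refine (injective_iff_map_eq_zero _).2 fun g hg => Subtype.ext ?_
  have h1 : T g = 0 := by rw [← hRT]; exact congrArg Subtype.val hg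
  refine eq_zero_of_eval_mul_eq_zero hp0 fun z => ?_
  rw [← hT', h1]
  simp

end HTwo

end DruryArveson

theorem theorem2 (d : ℕ) (hd : 2 ≤ d)
    (M : ClosedSubmodule ℂ (DruryArveson.HTwo d))
    (hM : ∀ (j : Fin d), ∀ f ∈ M, DruryArveson.HTwo.Mz j f ∈ M)
    (hne : M ≠ ⊥) :
    Cardinal.toENat (Module.rank ℂ (DruryArveson.HTwo d ⧸ M.toSubmodule)) = ⊤ ↔
      ∑ j : Fin d, Cardinal.toENat (LinearMap.rank (DruryArveson.HTwo.jump M j).toLinearMap) = ⊤ := by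
  have hquot : Module.rank ℂ (DruryArveson.HTwo d ⧸ M.toSubmodule) =
      Module.rank ℂ M.toSubmoduleᗮ :=
    (Submodule.quotientEquivOfIsCompl _ _ M.toSubmodule.isCompl_orthogonal).rank_eq
  have hsum : (∑ j : Fin d,
      Cardinal.toENat (LinearMap.rank (DruryArveson.HTwo.jump M j).toLinearMap) = ⊤) ↔
      ∃ j : Fin d, Cardinal.aleph0 ≤ LinearMap.rank (DruryArveson.HTwo.jump M j).toLinearMap := by
    refine (WithTop.sum_eq_top (M := ℕ)).trans ?_
    simp only [Finset.mem_univ, true_and]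
    exact exists_congr fun j => Cardinal.toENat_eq_top
  rw [hquot, hsum, Cardinal.toENat_eq_top]
  constructor
  · intro h
    by_contra! hJ
    refine h.not_gt (Module.rank_lt_aleph0_iff.2 ?_)
    refine DruryArveson.HTwo.finiteDimensional_orthogonal hd hM (fun j => ?_) fun h0 =>
      hne (ClosedSubmodule.toSubmodule_injective h0)
    have : FiniteDimensional ℂ
        (LinearMap.range (DruryArveson.HTwo.jump M j).toLinearMap) :=
      Module.rank_lt_aleph0_iff.1 (hJ j)
    refine DruryArveson.FiniteRank.of_mem
      ((LinearMap.range (DruryArveson.HTwo.jump M j).toLinearMap).map M.toSubmodule.subtype)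
      fun x => ⟨_, ⟨⟨x - M.toSubmodule.starProjection x,
        M.toSubmodule.sub_starProjection_mem_orthogonal x⟩, rfl⟩, rfl⟩
  · rintro ⟨j, hj⟩
    exact hj.trans (LinearMap.rank_le_domain _)
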